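/- Let $\mu$ be a probability measure on $\mathbb{Z}^d$, let $\mathcal{C}\subset\mathbb{R}^d$ be an open convex cone with vertex at the origin, and let $E=\overline{\mathcal{C}}\cap\mathbb{Z}^d$. Let $(X(t))$ be the substochastic random walk on $E$ with transition probabilities $p(x,y)=\mu(y-x)$, $x,y\in E$ (the random walk on $\mathbb{Z}^d$ with step distribution $\mu$, killed when it first leaves $E$), and let $G(x,y)=\sum_{n\ge 0}\mathbb{P}_x(X(n)=y)$, $x,y\in E$, be its Green function. Put $$R(\alpha)=\sum_{x\in\mathbb{Z}^d}e^{\langle\alpha,x\rangle}\mu(x)\in[0,+\infty],\quad \alpha\in\mathbb{R}^d,\qquad D=\{\alpha\in\mathbb{R}^d: R(\alpha)\le 1\}.$$ Assume that: 1. $(X(t))$ is transient on $E$, and there are $\kappa>0$ and a finite set $\mathcal{E}_0\subset\mathbb{Z}^d$ with $\mu(e)>0$ for all $e\in\mathcal{E}_0$ such that for any $x\ne y$ in $E$ there are $n\le\kappa|y-x|$ and $x_0,x_1,\dots,x_n\in E$ with $x_0=x$, $x_n=y$ and $x_j-x_{j-1}\in\mathcal{E}_0$ for $1\le j\le n$;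 2. $R$ is finite in a neighborhood of $D$, and $\sum_{x\in\mathbb{Z}^d}x\,\mu(x)\ne 0$. Then for any $u,v\in\overline{\mathcal{C}}$ and any sequences $(u_n),(v_n)$ in $E$ with $u_n/n\to u$ and $v_n/n\to v$, $$\lim_{n\to\infty}\frac1n\log G(u_n,v_n)=-\sup_{\alpha\in D}\langle\alpha,v-u\rangle .$$ -/

import Mathlib

open Filter Topology
open scoped ENNReal

noncomputable section

/-- The inclusion of `ℤ^d` into Euclidean space `ℝ^d`. -/
def latticeEmb {d : ℕ} (x : Fin d → ℤ) : EuclideanSpace ℝ (Fin d) :=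
  WithLp.toLp 2 (fun i => (x i : ℝ))

/-- The transition probability `p(x, y) = μ(y - x)`, for `x, y ∈ E`, of the random walk with step
distribution `μ` killed when it first leaves `E`. -/
def stepProb {d : ℕ} (μ : PMF (Fin d → ℤ)) (E : Set (Fin d → ℤ)) (x y : E) : ℝ≥0∞ :=
  μ ((y : Fin d → ℤ) - (x : Fin d → ℤ))

/-- `transProb μ E n x y` is `ℙ_x(X(n) = y)` for the random walk `(X(t))` killed outside `E`, that
is, the `(x, y)` entry of the `n`-th power of the substochastic transition matrix on `E`. -/
def transProb {d : ℕ} (μ : PMF (Fin d → ℤ)) (E : Set (Fin d → ℤ)) : ℕ → E → E → ℝ≥0∞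
  | 0, x, y => if x = y then 1 else 0
  | n + 1, x, y => ∑' z : E, stepProb μ E x z * transProb μ E n z y

/-- The Green function `G(x, y) = ∑_{n ≥ 0} ℙ_x(X(n) = y)` of the killed random walk. -/
def green {d : ℕ} (μ : PMF (Fin d → ℤ)) (E : Set (Fin d → ℤ)) (x y : E) : ℝ≥0∞ :=
  ∑' n : ℕ, transProb μ E n x y

/-- The killed random walk is transient on `E`: from every state the expected number of visits to
that state is finite. -/
def IsTransientOn {d : ℕ} (μ : PMF (Fin d → ℤ)) (E : Set (Fin d → ℤ)) : Prop :=
  ∀ x : E, green μ E x x < ∞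

/-- The communication condition: there are `κ > 0` and a finite set `E₀` of steps of positive
probability such that any two distinct points `x`, `y` of `E` are joined by a path inside `E` with
steps in `E₀` and of length at most `κ |y - x|`. -/
def Communicates {d : ℕ} (μ : PMF (Fin d → ℤ)) (E : Set (Fin d → ℤ)) : Prop :=
  ∃ κ : ℝ, 0 < κ ∧ ∃ E₀ : Finset (Fin d → ℤ), (∀ e ∈ E₀, 0 < μ e) ∧
    ∀ x ∈ E, ∀ y ∈ E, x ≠ y →
      ∃ (n : ℕ) (s : ℕ → Fin d → ℤ), s 0 = x ∧ s n = y ∧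
        (n : ℝ) ≤ κ * ‖latticeEmb y - latticeEmb x‖ ∧
        (∀ j ≤ n, s j ∈ E) ∧ ∀ j < n, s (j + 1) - s j ∈ E₀

/-- The step generating function `R(α) = ∑_{x ∈ ℤ^d} e^{⟨α, x⟩} μ(x)`, with values in `[0, ∞]`. -/
def stepGenFun {d : ℕ} (μ : PMF (Fin d → ℤ)) (α : EuclideanSpace ℝ (Fin d)) : ℝ≥0∞ :=
  ∑' x : Fin d → ℤ, ENNReal.ofReal (Real.exp (inner ℝ α (latticeEmb x))) * μ x

/-- The set `D = {α ∈ ℝ^d : R(α) ≤ 1}`. -/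
def subLevelD {d : ℕ} (μ : PMF (Fin d → ℤ)) : Set (EuclideanSpace ℝ (Fin d)) :=
  {α | stepGenFun μ α ≤ 1}

/-- The drift `∑_{x ∈ ℤ^d} x μ(x)`. -/
def drift {d : ℕ} (μ : PMF (Fin d → ℤ)) : EuclideanSpace ℝ (Fin d) :=
  ∑' x : Fin d → ℤ, (μ x).toReal • latticeEmb x

end

/-! Write `q = v - u`. For `R(β) < 1`, exponential Chebyshev gives `P_x(X(n) = y) ≤ R(β)^n e^{-⟨β, y
- x⟩}`, and summing a geometric series bounds `G` (`green_le`). The nonzero drift provides a point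
with `R < 1`, so convexity approximates every point of `D` by such `β`; this is the upper bound
(`eventually_green_le`).

For the lower bound, `D` is compact, so `⟨·, q⟩` has a maximizer `α` on it. If `q ≠ 0`, then `R(α) =
1`, and the law tilted by `α` has drift `m` with `q = τ m`, `τ > 0`
(`exists_eq_smul_drift_of_isMaxOn`). The tilted walk started near `n u` thus typically follows the
segment to `n v`, in about `τ n` steps. That segment lies in the closed cone; translating it by a
vector of order `n δ` into the open cone leaves room for a tube of width of order `n δ`, which the
walk leaves with exponentially small probability (`half_mul_exp_le_green`). Undoing the tilt
produces `e^{-n⟨α, q⟩}`. The displacements at both ends cost only `e^{-O(nδ)}` by a Harnack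
inequality (`Communicates.exists_harnack`), and `δ` is arbitrary. If `q = 0`, the Harnack inequality
alone suffices.

The exit estimate uses no path measure: it is an induction comparing a superharmonic function with a
space-time supersolution (`le_add_mul_of_superharmonic`). -/

section LatticeEmbedding

/-! ### Lattice points in Euclidean space. -/

variable {d : ℕ}

@[simp] theorem latticeEmb_apply (x : Fin d → ℤ) (i : Fin d) : latticeEmb x i = (x i : ℝ) := rfl

theorem latticeEmb_add (x y : Fin d → ℤ) : latticeEmb (x + y) = latticeEmb x + latticeEmb y := by
  ext i; simp

theorem latticeEmb_sub (x y : Fin d → ℤ) : latticeEmb (x - y) = latticeEmb x - latticeEmb y := by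
  ext i; simp

theorem latticeEmb_nsmul (n : ℕ) (x : Fin d → ℤ) :
    latticeEmb (n • x) = (n : ℝ) • latticeEmb x := by
  ext i; simp

theorem norm_le_of_forall_abs_le {x : EuclideanSpace ℝ (Fin d)} {r : ℝ} (hr : 0 ≤ r)
    (h : ∀ i, |x i| ≤ r) : ‖x‖ ≤ d * r := by
  rw [EuclideanSpace.norm_eq]
  apply Real.sqrt_le_iff.mpr
  refine ⟨by positivity, ?_⟩
  calc ∑ i, ‖x i‖ ^ 2 ≤ ∑ _i : Fin d, r ^ 2 := by
        gcongr with i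
        exact h i
    _ = d * r ^ 2 := by simp
    _ ≤ (d * r) ^ 2 := by
        rw [mul_pow]
        gcongr
        exact_mod_cast Nat.le_self_pow two_ne_zero d

theorem exists_latticeEmb_norm_sub_le (z : EuclideanSpace ℝ (Fin d)) :
    ∃ x : Fin d → ℤ, ‖latticeEmb x - z‖ ≤ d := by
  refine ⟨fun i => ⌊z i⌋, ?_⟩
  simpa using norm_le_of_forall_abs_le (x := latticeEmb (fun i => ⌊z i⌋) - z) zero_le_one
    fun i => by
      simp only [PiLp.sub_apply, latticeEmb_apply]
      rw [abs_le]
      constructor <;> linarith [Int.floor_le (z i), Int.lt_floor_add_one (z i)]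

theorem ofReal_exp_add (a b : ℝ) :
    ENNReal.ofReal (Real.exp (a + b))
      = ENNReal.ofReal (Real.exp a) * ENNReal.ofReal (Real.exp b) := by
  rw [Real.exp_add, ENNReal.ofReal_mul (Real.exp_nonneg a)]

theorem ofReal_exp_mul_neg (a : ℝ) :
    ENNReal.ofReal (Real.exp a) * ENNReal.ofReal (Real.exp (-a)) = 1 := by
  rw [← ofReal_exp_add]; simp

end LatticeEmbedding

/-! ### Green function: Chernoff bound, Harnack inequality. -/

section Green

variable {d : ℕ} (μ : PMF (Fin d → ℤ)) {E : Set (Fin d → ℤ)}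

theorem tsum_stepProb_mul_green_le (x y : E) :
    ∑' z : E, stepProb μ E x z * green μ E z y ≤ green μ E x y := by
  simp only [green, ← ENNReal.tsum_mul_left]
  rw [ENNReal.tsum_comm]
  rw [tsum_eq_zero_add' (f := fun n => transProb μ E n x y) ENNReal.summable]
  exact le_add_self

theorem stepProb_mul_green_le (x y z : E) :
    stepProb μ E x z * green μ E z y ≤ green μ E x y :=
  (ENNReal.le_tsum z).trans (tsum_stepProb_mul_green_le μ x y)

theorem one_le_green_self (x : E) : 1 ≤ green μ E x x := by
  have h := ENNReal.le_tsum (f := fun n => transProb μ E n x x) 0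
  simpa [transProb, green] using h

theorem tsum_subtype_step_le (x : Fin d → ℤ) (f : (Fin d → ℤ) → ℝ≥0∞) :
    ∑' z : E, f ((z : Fin d → ℤ) - x) ≤ ∑' z, f z := by
  refine (ENNReal.tsum_comp_le_tsum_of_injective (f := fun z : E => (z : Fin d → ℤ) - x) ?_ f)
  intro a b h
  exact Subtype.ext (sub_left_injective h)

/-- First-step induction: each step contributes one factor `R(α)`, and killing only discards
nonnegative terms. -/
theorem transProb_le (α : EuclideanSpace ℝ (Fin d)) (n : ℕ) (x y : E) :
    transProb μ E n x y ≤ stepGenFun μ α ^ n *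
      ENNReal.ofReal (Real.exp (-inner ℝ α (latticeEmb (y : Fin d → ℤ) - latticeEmb x.1))) := by
  induction n generalizing x with
  | zero =>
    by_cases h : x = y
    · simp [transProb, h]
    · simp [transProb, h]
  | succ n ih =>
    calc transProb μ E (n + 1) x y
        = ∑' z : E, stepProb μ E x z * transProb μ E n z y := rfl
      _ ≤ ∑' z : E, stepGenFun μ α ^ n *
            ENNReal.ofReal (Real.exp (-inner ℝ α (latticeEmb y.1 - latticeEmb x.1))) *
            (ENNReal.ofReal (Real.exp (inner ℝ α (latticeEmb (z.1 - x.1)))) * μ (z.1 - x.1)) := by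
          refine ENNReal.tsum_le_tsum fun z => ?_
          refine (mul_le_mul_right (ih z) _).trans_eq ?_
          have : -inner ℝ α (latticeEmb y.1 - latticeEmb z.1)
              = -inner ℝ α (latticeEmb y.1 - latticeEmb x.1)
                + inner ℝ α (latticeEmb (z.1 - x.1)) := by
            simp only [latticeEmb_sub, inner_sub_right]; ring
          rw [this, ofReal_exp_add, stepProb]
          ring
      _ ≤ _ := by
          rw [ENNReal.tsum_mul_left]
          have := tsum_subtype_step_le (E := E) x.1
            (fun z => ENNReal.ofReal (Real.exp (inner ℝ α (latticeEmb z))) * μ z)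
          refine (mul_le_mul_right this _).trans_eq ?_
          rw [← stepGenFun, pow_succ]
          ring

theorem green_le (α : EuclideanSpace ℝ (Fin d)) (x y : E) :
    green μ E x y ≤ (1 - stepGenFun μ α)⁻¹ *
      ENNReal.ofReal (Real.exp (-inner ℝ α (latticeEmb y.1 - latticeEmb x.1))) := by
  rw [← ENNReal.tsum_geometric, ← ENNReal.tsum_mul_right]
  exact ENNReal.tsum_le_tsum fun n => transProb_le μ α n x y

variable {μ}

theorem Communicates.exists_path (h : Communicates μ E) :
    ∃ a : ℝ, 0 ≤ a ∧ ∃ κ : ℝ, 0 < κ ∧ ∀ x ∈ E, ∀ y ∈ E,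
      ∃ (n : ℕ) (s : ℕ → Fin d → ℤ), s 0 = x ∧ s n = y ∧
        (n : ℝ) ≤ κ * ‖latticeEmb y - latticeEmb x‖ ∧ (∀ j ≤ n, s j ∈ E) ∧
        ∀ j < n, ENNReal.ofReal (Real.exp (-a)) ≤ μ (s (j + 1) - s j) := by
  obtain ⟨κ, hκ, E₀, hE₀, hpath⟩ := h
  -- The sum dominates every `-log μ(e)`, so `e^{-a} ≤ μ(e)` for all allowed steps at once.
  refine ⟨∑ e ∈ E₀, |Real.log (μ e).toReal|, Finset.sum_nonneg fun _ _ => abs_nonneg _, κ, hκ, ?_⟩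
  intro x hx y hy
  rcases eq_or_ne x y with rfl | hxy
  · exact ⟨0, fun _ => x, rfl, rfl, by simp, fun _ _ => hx, by simp⟩
  obtain ⟨n, s, h0, hn, hle, hmem, hstep⟩ := hpath x hx y hy hxy
  refine ⟨n, s, h0, hn, hle, hmem, fun j hj => ?_⟩
  have he := hstep j hj
  set e := s (j + 1) - s j
  have hpos : 0 < (μ e).toReal := ENNReal.toReal_pos (hE₀ e he).ne' (μ.apply_ne_top e)
  rw [ENNReal.ofReal_le_iff_le_toReal (μ.apply_ne_top e), ← Real.le_log_iff_exp_le hpos]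
  have := Finset.single_le_sum (f := fun e => |Real.log (μ e).toReal|)
    (fun _ _ => abs_nonneg _) he
  linarith [neg_abs_le (Real.log (μ e).toReal)]

/-- Every step of a connecting path inside `E` costs a factor at least `e^{-a}`, and the path has
length at most `κ |y - x|`. -/
theorem Communicates.exists_harnack (h : Communicates μ E) :
    ∃ M : ℝ, 0 ≤ M ∧ ∀ x y w : E,
      ENNReal.ofReal (Real.exp (-(M * ‖latticeEmb y.1 - latticeEmb x.1‖))) * green μ E y w
        ≤ green μ E x w := by
  obtain ⟨a, ha, κ, hκ, hpath⟩ := h.exists_path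
  refine ⟨a * κ, by positivity, fun x y w => ?_⟩
  obtain ⟨n, s, h0, hn, hle, hmem, hstep⟩ := hpath x x.2 y y.2
  have key : ∀ j (hj : j ≤ n), ENNReal.ofReal (Real.exp (-(a * j))) * green μ E ⟨s j, hmem j hj⟩ w
      ≤ green μ E x w := by
    intro j
    induction j with
    | zero => intro hj; simp [h0]
    | succ j ih =>
      intro hj
      refine le_trans ?_ (ih (by omega))
      have e : -(a * ((j + 1 : ℕ) : ℝ)) = -(a * j) + -a := by push_cast; ring
      rw [e, ofReal_exp_add, mul_assoc]
      gcongr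
      refine le_trans ?_ (stepProb_mul_green_le μ ⟨s j, hmem j (by omega)⟩ w ⟨s (j + 1), hmem _ hj⟩)
      gcongr
      exact hstep j (by omega)
  have hy : (⟨s n, hmem n le_rfl⟩ : E) = y := Subtype.ext hn
  refine le_trans ?_ (hy ▸ key n le_rfl)
  gcongr ENNReal.ofReal (Real.exp ?_) * _
  rw [mul_assoc]
  exact neg_le_neg (mul_le_mul_of_nonneg_left hle ha)

/-- A single term of `R(α) ≤ 1` gives `⟨α, e⟩ ≤ -log μ(e) ≤ a` for each step `e` of the path. The
bound is uniform in `α`, which later makes `D` bounded. -/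
theorem Communicates.exists_inner_le (h : Communicates μ E) :
    ∃ M : ℝ, 0 ≤ M ∧ ∀ α ∈ subLevelD μ, ∀ x ∈ E, ∀ y ∈ E,
      inner ℝ α (latticeEmb y - latticeEmb x) ≤ M * ‖latticeEmb y - latticeEmb x‖ := by
  obtain ⟨a, ha, κ, hκ, hpath⟩ := h.exists_path
  refine ⟨a * κ, by positivity, fun α hα x hx y hy => ?_⟩
  obtain ⟨n, s, h0, hn, hle, -, hstep⟩ := hpath x hx y hy
  have hα1 : stepGenFun μ α ≤ 1 := hα
  have key : ∀ j ≤ n, inner ℝ α (latticeEmb (s j) - latticeEmb x) ≤ a * j := by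
    intro j
    induction j with
    | zero => intro _; simp [h0]
    | succ j ih =>
      intro hj
      have h1 := ih (by omega)
      have h2 : ENNReal.ofReal (Real.exp (inner ℝ α (latticeEmb (s (j + 1) - s j)) + -a)) ≤ 1 := by
        rw [ofReal_exp_add]
        refine le_trans ?_ ((ENNReal.le_tsum (s (j + 1) - s j)).trans hα1)
        gcongr
        exact hstep j (by omega)
      rw [ENNReal.ofReal_le_one, Real.exp_le_one_iff, latticeEmb_sub] at h2
      rw [inner_sub_right] at h1 h2 ⊢
      push_cast
      linarith
  have := key n le_rfl
  rw [hn] at this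
  nlinarith [mul_le_mul_of_nonneg_left hle ha]

end Green

/-! ### Comparison principle for superharmonic functions. -/

section Superharmonic

variable {d : ℕ} {E : Set (Fin d → ℤ)} {ν : PMF (Fin d → ℤ)}

/-- A maximal inequality of Doob type: a superharmonic function on `E` which is at least `c` at a
target is at least `c` minus `c` times a space-time superharmonic function which is at least `1`
outside of `E` and away from the target. -/
theorem le_add_mul_of_superharmonic {g : E → ℝ≥0∞} {H : ℕ → (Fin d → ℤ) → ℝ≥0∞} {c : ℝ≥0∞} {N : ℕ}
    (hg : ∀ x : E, ∑' w : E, ν (w.1 - x.1) * g w ≤ g x)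
    (hH : ∀ n x, ∑' z, ν z * H n (x + z) ≤ H (n + 1) x)
    (hout : ∀ n ≤ N, ∀ w ∉ E, 1 ≤ H n w)
    (h0 : ∀ x : E, c ≤ g x + c * H 0 x) :
    ∀ n ≤ N, ∀ x : E, c ≤ g x + c * H n x := by
  classical
  intro n
  induction n with
  | zero => exact fun _ => h0
  | succ n ih =>
    intro hn x
    -- Extension of `g` by zero: off `E` the term `c * H` alone dominates `c`.
    let G : (Fin d → ℤ) → ℝ≥0∞ := fun w => if hw : w ∈ E then g ⟨w, hw⟩ else 0
    have hG : ∑' z, ν z * G (x.1 + z) = ∑' w : E, ν (w.1 - x.1) * g w := by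
      rw [← (Equiv.subRight x.1).tsum_eq]
      have h1 : ∀ w : E, ν (w.1 - x.1) * g w = (fun w => ν (w - x.1) * G w) w.1 := by
        intro w; simp [G]
      have h2 : Function.support (fun w => ν (w - x.1) * G w) ⊆ E := by
        intro w hw
        by_contra hwE
        exact hw (by simp [G, hwE])
      rw [tsum_congr h1, tsum_subtype_eq_of_support_subset h2]
      exact tsum_congr fun w => by simp
    have hc : ∀ w, c ≤ G w + c * H n w := by
      intro w
      by_cases hw : w ∈ E
      · simpa [G, hw] using ih (by omega) ⟨w, hw⟩
      · simpa [G, hw] using mul_le_mul_right (hout n (by omega) w hw) c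
    calc c = ∑' z, ν z * c := by rw [ENNReal.tsum_mul_right, ν.tsum_coe, one_mul]
      _ ≤ ∑' z, (ν z * G (x.1 + z) + c * (ν z * H n (x.1 + z))) := by
          refine ENNReal.tsum_le_tsum fun z => ?_
          refine (mul_le_mul_right (hc (x.1 + z)) _).trans_eq ?_
          ring
      _ = (∑' w : E, ν (w.1 - x.1) * g w) + c * ∑' z, ν z * H n (x.1 + z) := by
          rw [ENNReal.tsum_add, ENNReal.tsum_mul_left, hG]
      _ ≤ _ := by
          gcongr
          · exact hg x
          · exact hH n x

end Superharmonic

/-! ### Generating function, tilting, and maximizers on `D`. -/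

section GeneratingFunction

open MeasureTheory ProbabilityTheory

variable {d : ℕ} (μ ν : PMF (Fin d → ℤ))

theorem stepGenFun_zero : stepGenFun μ 0 = 1 := by
  simp [stepGenFun, μ.tsum_coe]

theorem stepGenFun_eq_lintegral (β : EuclideanSpace ℝ (Fin d)) :
    stepGenFun ν β = ∫⁻ x, ENNReal.ofReal (Real.exp (inner ℝ β (latticeEmb x))) ∂ν.toMeasure := by
  rw [lintegral_countable']
  exact tsum_congr fun x => by rw [ν.toMeasure_apply_singleton x (measurableSet_singleton x)]

theorem integrable_exp_inner {β : EuclideanSpace ℝ (Fin d)} (h : stepGenFun ν β < ∞) :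
    Integrable (fun x => Real.exp (inner ℝ β (latticeEmb x))) ν.toMeasure := by
  refine ⟨(Measurable.of_discrete).aestronglyMeasurable, ?_⟩
  rw [hasFiniteIntegral_iff_ofReal (ae_of_all _ fun _ => Real.exp_nonneg _),
    ← stepGenFun_eq_lintegral]
  exact h

theorem stepGenFun_eq_ofReal_integral {β : EuclideanSpace ℝ (Fin d)} (h : stepGenFun ν β < ∞) :
    stepGenFun ν β
      = ENNReal.ofReal (∫ x, Real.exp (inner ℝ β (latticeEmb x)) ∂ν.toMeasure) := by
  rw [ofReal_integral_eq_lintegral_ofReal (integrable_exp_inner ν h)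
    (ae_of_all _ fun _ => Real.exp_nonneg _), stepGenFun_eq_lintegral]

variable {ν}

theorem eventually_stepGenFun_smul_lt_top (hfin : ∀ᶠ β in 𝓝 0, stepGenFun ν β < ∞)
    (h : EuclideanSpace ℝ (Fin d)) : ∀ᶠ s in 𝓝 (0 : ℝ), stepGenFun ν (s • h) < ∞ := by
  have : Tendsto (fun s : ℝ => s • h) (𝓝 0) (𝓝 0) := by
    have : Continuous fun s : ℝ => s • h := by fun_prop
    simpa using this.tendsto 0
  exact this.eventually hfin

theorem zero_mem_interior_integrableExpSet (hfin : ∀ᶠ β in 𝓝 0, stepGenFun ν β < ∞)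
    (h : EuclideanSpace ℝ (Fin d)) :
    (0 : ℝ) ∈ interior (integrableExpSet (fun x => inner ℝ h (latticeEmb x)) ν.toMeasure) := by
  rw [mem_interior_iff_mem_nhds]
  filter_upwards [eventually_stepGenFun_smul_lt_top hfin h] with s hs
  simpa [integrableExpSet, real_inner_smul_left] using integrable_exp_inner ν hs

/-- Exponential moments near `0` give first moments of each coordinate. This makes `drift` the true
mean and not the default value `0` of a divergent `tsum`. -/
theorem integrable_latticeEmb (hfin : ∀ᶠ β in 𝓝 0, stepGenFun ν β < ∞) :
    Integrable latticeEmb ν.toMeasure := by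
  have h : ∀ x : Fin d → ℤ, latticeEmb x = ∑ i, inner ℝ (EuclideanSpace.basisFun (Fin d) ℝ i)
      (latticeEmb x) • EuclideanSpace.basisFun (Fin d) ℝ i := fun x =>
    ((EuclideanSpace.basisFun (Fin d) ℝ).sum_repr' (latticeEmb x)).symm
  rw [funext h]
  refine integrable_finsetSum _ fun i _ => Integrable.smul_const ?_ _
  have := integrable_pow_of_mem_interior_integrableExpSet
    (zero_mem_interior_integrableExpSet hfin (EuclideanSpace.basisFun (Fin d) ℝ i)) 1
  simpa using this

theorem integral_inner_latticeEmb (hfin : ∀ᶠ β in 𝓝 0, stepGenFun ν β < ∞)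
    (h : EuclideanSpace ℝ (Fin d)) :
    ∫ x, inner ℝ h (latticeEmb x) ∂ν.toMeasure = inner ℝ h (drift ν) := by
  rw [integral_inner (integrable_latticeEmb hfin), PMF.integral_eq_tsum _ _
    (integrable_latticeEmb hfin), drift]

/-- Both sides equal `1` at `s = 0`, where their derivatives are `⟨h, drift⟩` and `b`. -/
theorem eventually_stepGenFun_smul_lt (hfin : ∀ᶠ β in 𝓝 0, stepGenFun ν β < ∞)
    {h : EuclideanSpace ℝ (Fin d)} {b : ℝ} (hb : inner ℝ h (drift ν) < b) :
    ∀ᶠ s in 𝓝[>] (0 : ℝ), stepGenFun ν (s • h) < ENNReal.ofReal (Real.exp (s * b)) := by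
  have hmem := zero_mem_interior_integrableExpSet hfin h
  have hder := hasDerivAt_mgf hmem
  simp only [zero_mul, Real.exp_zero, mul_one, integral_inner_latticeEmb hfin] at hder
  have hexp : HasDerivAt (fun s : ℝ => Real.exp (s * b)) b 0 := by
    simpa using ((hasDerivAt_id (0 : ℝ)).mul_const b).exp
  have hslope := (hexp.sub hder).tendsto_slope_zero_right
  filter_upwards [hslope.eventually (lt_mem_nhds (sub_pos.2 hb)), self_mem_nhdsWithin,
    nhdsWithin_le_nhds (eventually_stepGenFun_smul_lt_top hfin h)] with s hs hs0 hsfin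
  have hs0' : 0 < s := hs0
  rw [stepGenFun_eq_ofReal_integral ν hsfin, ENNReal.ofReal_lt_ofReal_iff (Real.exp_pos _)]
  simp only [Pi.sub_apply, zero_add, smul_eq_mul, zero_mul, Real.exp_zero, mgf_zero,
    sub_self, sub_zero] at hs
  have := (mul_pos_iff_of_pos_left (inv_pos.2 hs0')).1 hs
  simpa [mgf, real_inner_smul_left] using this

/-- Integrate `1 + t ≤ e^t`. -/
theorem ofReal_one_add_inner_drift_le (hfin : ∀ᶠ β in 𝓝 0, stepGenFun ν β < ∞)
    (β : EuclideanSpace ℝ (Fin d)) :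
    ENNReal.ofReal (1 + inner ℝ β (drift ν)) ≤ stepGenFun ν β := by
  rcases (le_top : stepGenFun ν β ≤ ∞).eq_or_lt with h | h
  · simp [h]
  rw [stepGenFun_eq_ofReal_integral ν h]
  apply ENNReal.ofReal_le_ofReal
  have hint : Integrable (fun x => inner ℝ β (latticeEmb x)) ν.toMeasure :=
    (integrable_latticeEmb hfin).const_inner β
  have h1 : ∫ x, (1 + inner ℝ β (latticeEmb x)) ∂ν.toMeasure = 1 + inner ℝ β (drift ν) := by
    rw [integral_add (integrable_const _) hint, integral_inner_latticeEmb hfin]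
    simp
  rw [← h1]
  refine integral_mono ((integrable_const _).add hint) (integrable_exp_inner ν h) fun x => ?_
  simpa [add_comm] using Real.add_one_le_exp (inner ℝ β (latticeEmb x))

theorem stepGenFun_convex_le (α β : EuclideanSpace ℝ (Fin d)) {t : ℝ} (h0 : 0 ≤ t) (h1 : t ≤ 1) :
    stepGenFun μ ((1 - t) • α + t • β)
      ≤ ENNReal.ofReal (1 - t) * stepGenFun μ α + ENNReal.ofReal t * stepGenFun μ β := by
  simp only [stepGenFun, ← ENNReal.tsum_mul_left, ← ENNReal.tsum_add]
  refine ENNReal.tsum_le_tsum fun x => ?_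
  rw [← mul_assoc, ← mul_assoc, ← add_mul, ← ENNReal.ofReal_mul (sub_nonneg.2 h1),
    ← ENNReal.ofReal_mul h0, ← ENNReal.ofReal_add
      (mul_nonneg (sub_nonneg.2 h1) (Real.exp_nonneg _)) (mul_nonneg h0 (Real.exp_nonneg _))]
  gcongr
  simpa [inner_add_left, real_inner_smul_left] using convexOn_exp.2 (Set.mem_univ (inner ℝ α
    (latticeEmb x))) (Set.mem_univ (inner ℝ β (latticeEmb x))) (sub_nonneg.2 h1) h0 (by ring)

/-- Convex combinations of a point where `R ≤ 1` and one where `R < 1`. -/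
theorem stepGenFun_convex_lt_one {α β : EuclideanSpace ℝ (Fin d)} (hα : stepGenFun μ α ≤ 1)
    (hβ : stepGenFun μ β < 1) {t : ℝ} (h0 : 0 < t) (h1 : t ≤ 1) :
    stepGenFun μ ((1 - t) • α + t • β) < 1 := by
  refine (stepGenFun_convex_le μ α β h0.le h1).trans_lt ?_
  calc _ < ENNReal.ofReal (1 - t) * 1 + ENNReal.ofReal t * 1 := by
        refine ENNReal.add_lt_add_of_le_of_lt ?_ (by gcongr) ?_
        · exact (ENNReal.mul_lt_top ENNReal.ofReal_lt_top (hα.trans_lt ENNReal.one_lt_top)).ne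
        · exact ENNReal.mul_lt_mul_right (by simpa using h0) ENNReal.ofReal_ne_top hβ
    _ = 1 := by
        rw [mul_one, mul_one, ← ENNReal.ofReal_add (sub_nonneg.2 h1) h0.le]
        simp

/-- `R` is a supremum of continuous finite sums, hence lower semicontinuous. -/
theorem isClosed_subLevelD : IsClosed (subLevelD μ) := by
  have : subLevelD μ = ⋂ F : Finset (Fin d → ℤ), {α : EuclideanSpace ℝ (Fin d) |
      ∑ x ∈ F, ENNReal.ofReal (Real.exp (inner ℝ α (latticeEmb x))) * μ x ≤ 1} := by
    ext α
    simp [subLevelD, stepGenFun, ENNReal.tsum_eq_iSup_sum]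
  rw [this]
  refine isClosed_iInter fun F => isClosed_le ?_ continuous_const
  refine continuous_finsetSum _ fun x _ => ENNReal.continuous_mul_const (μ.apply_ne_top x) |>.comp ?_
  exact ENNReal.continuous_ofReal.comp (by fun_prop)

/-- The step distribution tilted by `α`, for `R(α) = 1`. -/
noncomputable def tiltPMF (α : EuclideanSpace ℝ (Fin d)) (h : stepGenFun μ α = 1) :
    PMF (Fin d → ℤ) :=
  ⟨fun x => ENNReal.ofReal (Real.exp (inner ℝ α (latticeEmb x))) * μ x,
    ENNReal.summable.hasSum_iff.2 h⟩

variable {μ}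

theorem tiltPMF_apply {α : EuclideanSpace ℝ (Fin d)} (h : stepGenFun μ α = 1) (x : Fin d → ℤ) :
    tiltPMF μ α h x = ENNReal.ofReal (Real.exp (inner ℝ α (latticeEmb x))) * μ x := rfl

theorem stepGenFun_tiltPMF {α : EuclideanSpace ℝ (Fin d)} (h : stepGenFun μ α = 1)
    (β : EuclideanSpace ℝ (Fin d)) :
    stepGenFun (tiltPMF μ α h) β = stepGenFun μ (α + β) := by
  refine tsum_congr fun x => ?_
  rw [tiltPMF_apply, inner_add_left, ofReal_exp_add]
  ring

theorem eventually_stepGenFun_tiltPMF_lt_top (hR : ∀ᶠ α in 𝓝ˢ (subLevelD μ), stepGenFun μ α < ∞)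
    {α : EuclideanSpace ℝ (Fin d)} (h : stepGenFun μ α = 1) :
    ∀ᶠ β in 𝓝 0, stepGenFun (tiltPMF μ α h) β < ∞ := by
  simp only [stepGenFun_tiltPMF]
  have h1 := (eventually_nhdsSet_iff_forall.1 hR) α h.le
  have h2 : Tendsto (fun β => α + β) (𝓝 0) (𝓝 α) := by
    simpa using (continuous_const_add α).tendsto 0
  exact h2.eventually h1

theorem exists_stepGenFun_lt_one (hR : ∀ᶠ α in 𝓝ˢ (subLevelD μ), stepGenFun μ α < ∞)
    (hdrift : drift μ ≠ 0) : ∃ α, stepGenFun μ α < 1 := by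
  have hfin := (eventually_nhdsSet_iff_forall.1 hR) 0 (stepGenFun_zero μ).le
  have hneg : inner ℝ (-drift μ) (drift μ) < 0 := by
    rw [inner_neg_left, neg_lt_zero]
    exact real_inner_self_pos.2 hdrift
  obtain ⟨s, hs⟩ := (eventually_stepGenFun_smul_lt hfin hneg).exists
  exact ⟨_, by simpa using hs⟩

/-- If `R(α) < 1`, then, `R` being finite at some `α + s q`, convexity keeps `R < 1` a little way
along this segment, where `⟨·, q⟩` is larger. -/
theorem stepGenFun_eq_one_of_isMaxOn (hR : ∀ᶠ α in 𝓝ˢ (subLevelD μ), stepGenFun μ α < ∞)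
    {q α : EuclideanSpace ℝ (Fin d)} (hq : q ≠ 0) (hα : α ∈ subLevelD μ)
    (hmax : ∀ β ∈ subLevelD μ, inner ℝ β q ≤ inner ℝ α q) : stepGenFun μ α = 1 := by
  have hα1 : stepGenFun μ α ≤ 1 := hα
  refine hα1.antisymm (not_lt.1 fun hlt => ?_)
  have hc : Tendsto (fun s : ℝ => α + s • q) (𝓝[>] 0) (𝓝 α) := by
    have : Continuous fun s : ℝ => α + s • q := by fun_prop
    simpa using (this.tendsto 0).mono_left nhdsWithin_le_nhds
  obtain ⟨s, hsfin, hs⟩ := ((hc.eventually (eventually_nhdsSet_iff_forall.1 hR α hα)).and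
    self_mem_nhdsWithin).exists
  have hs0 : 0 < s := hs
  have hlim : Tendsto (fun t : ℝ => ENNReal.ofReal (1 - t) * stepGenFun μ α
      + ENNReal.ofReal t * stepGenFun μ (α + s • q)) (𝓝[>] 0) (𝓝 (stepGenFun μ α)) := by
    have h1 : Continuous fun t : ℝ => ENNReal.ofReal (1 - t) * stepGenFun μ α
        + ENNReal.ofReal t * stepGenFun μ (α + s • q) :=
      ((ENNReal.continuous_mul_const (hlt.trans ENNReal.one_lt_top).ne).comp
        (ENNReal.continuous_ofReal.comp (by fun_prop))).add
      ((ENNReal.continuous_mul_const hsfin.ne).comp ENNReal.continuous_ofReal)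
    simpa using (h1.tendsto 0).mono_left nhdsWithin_le_nhds
  obtain ⟨t, ht, ht0, ht1⟩ := ((hlim.eventually (gt_mem_nhds hlt)).and
    (Ioc_mem_nhdsGT (zero_lt_one' ℝ))).exists
  have hmem : (1 - t) • α + t • (α + s • q) ∈ subLevelD μ :=
    ((stepGenFun_convex_le μ α (α + s • q) ht0.le ht1).trans_lt ht).le
  have := hmax _ hmem
  simp only [inner_add_left, real_inner_smul_left] at this
  have := mul_pos ht0 (mul_pos hs0 (real_inner_self_pos.2 hq))
  linarith

/-- At a maximizer of `⟨·, q⟩` on `D`, the tilted drift is a positive multiple of `q`. -/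
theorem exists_eq_smul_drift_of_isMaxOn (hR : ∀ᶠ α in 𝓝ˢ (subLevelD μ), stepGenFun μ α < ∞)
    (hdrift : drift μ ≠ 0) {q α : EuclideanSpace ℝ (Fin d)} (hq : q ≠ 0)
    (hmax : ∀ β ∈ subLevelD μ, inner ℝ β q ≤ inner ℝ α q) (h : stepGenFun μ α = 1) :
    ∃ τ : ℝ, 0 < τ ∧ q = τ • drift (tiltPMF μ α h) := by
  have hfin := eventually_stepGenFun_tiltPMF_lt_top hR h
  set m := drift (tiltPMF μ α h) with hm
  -- With zero tilted drift, `α` would minimize `R`, against the existence of a point with `R < 1`.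
  have hm0 : m ≠ 0 := by
    intro h0
    obtain ⟨α₀, hα₀⟩ := exists_stepGenFun_lt_one hR hdrift
    have := ofReal_one_add_inner_drift_le hfin (α₀ - α)
    rw [stepGenFun_tiltPMF, ← hm, h0] at this
    simp only [inner_zero_right, add_zero, ENNReal.ofReal_one, add_sub_cancel] at this
    exact absurd hα₀ (not_lt.2 this)
  have hmm : 0 < inner ℝ m m := real_inner_self_pos.2 hm0
  -- A direction with `⟨e, m⟩ < 0` enters `D` from `α`, so maximality applies.
  have hdir : ∀ e, inner ℝ e m < 0 → inner ℝ e q ≤ 0 := by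
    intro e he
    obtain ⟨s, hs, hs0⟩ := ((eventually_stepGenFun_smul_lt hfin he).and self_mem_nhdsWithin).exists
    rw [stepGenFun_tiltPMF, mul_zero, Real.exp_zero, ENNReal.ofReal_one] at hs
    have := hmax _ hs.le
    rw [inner_add_left, real_inner_smul_left] at this
    have hs0' : 0 < s := hs0
    by_contra hpos
    have := mul_pos hs0' (not_le.1 hpos)
    linarith
  set τ : ℝ := inner ℝ m q / inner ℝ m m with hτ
  have hτ0 : 0 ≤ τ := by
    have := hdir (-m) (by rw [inner_neg_left]; linarith)
    rw [inner_neg_left] at this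
    exact div_nonneg (by linarith) hmm.le
  have hτm : τ * inner ℝ m m = inner ℝ m q := by rw [hτ]; field_simp
  set r := q - τ • m with hr
  have hrm : inner ℝ r m = 0 := by
    rw [hr, inner_sub_left, real_inner_smul_left, hτm, real_inner_comm]; ring
  have hrq : inner ℝ r q = inner ℝ r r := by
    have : q = r + τ • m := by rw [hr]; abel
    rw [this, inner_add_right, real_inner_smul_right, hrm]
    ring
  -- `r` is only orthogonal to `m`, so `hdir` is applied to `r - ε m` and `ε → 0`.
  have hr0 : inner ℝ r r ≤ 0 := by
    have hlim : Tendsto (fun ε : ℝ => inner ℝ (r - ε • m) q) (𝓝[>] 0) (𝓝 (inner ℝ r q)) := by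
      have : Continuous fun ε : ℝ => inner ℝ (r - ε • m) q := by fun_prop
      simpa using (this.tendsto 0).mono_left nhdsWithin_le_nhds
    rw [← hrq]
    refine le_of_tendsto hlim ?_
    filter_upwards [self_mem_nhdsWithin] with ε hε
    apply hdir
    rw [inner_sub_left, hrm, real_inner_smul_left, zero_sub, neg_lt_zero]
    exact mul_pos hε hmm
  have hqτ : q = τ • m := by
    have : r = 0 := by
      by_contra h0
      exact absurd hr0 (not_le.2 (real_inner_self_pos.2 h0))
    exact sub_eq_zero.1 this
  refine ⟨τ, hτ0.lt_of_ne ?_, hqτ⟩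
  rintro h0
  exact hq (by rw [hqτ, ← h0, zero_smul])

end GeneratingFunction

/-! ### Room inside the cone; boundedness of `D`. -/

section Cone

variable {d : ℕ}

theorem ConvexCone.smul_add_mem_closure {V : Type*} [AddCommGroup V] [Module ℝ V]
    [TopologicalSpace V] [IsTopologicalAddGroup V] [ContinuousConstSMul ℝ V] (C : ConvexCone ℝ V)
    {x z : V} {a : ℝ} (ha : 0 ≤ a) (hx : x ∈ closure (C : Set V)) (hz : z ∈ closure (C : Set V)) :
    a • x + z ∈ closure (C : Set V) := by
  rcases ha.eq_or_lt with rfl | ha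
  · simpa using hz
  · exact C.closure.add_mem (C.closure.smul_mem ha hx) hz

theorem ConvexCone.exists_closedBall_latticeEmb_subset
    {C : ConvexCone ℝ (EuclideanSpace ℝ (Fin d))}
    (hC : IsOpen (C : Set (EuclideanSpace ℝ (Fin d))))
    (hne : (C : Set (EuclideanSpace ℝ (Fin d))).Nonempty) (r : ℝ) :
    ∃ w : Fin d → ℤ, Metric.closedBall (latticeEmb w) r ⊆ C := by
  obtain ⟨c, hc⟩ := hne
  obtain ⟨ε, hε, hball⟩ := Metric.isOpen_iff.1 hC c hc
  -- Scaling makes the inner ball of radius `|r| + d + 1`, which absorbs `r` and the rounding error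
  -- `d`.
  set t : ℝ := (|r| + d + 1) / ε with ht
  have ht0 : 0 < t := by positivity
  have htε : t * ε = |r| + d + 1 := by rw [ht]; field_simp
  obtain ⟨w, hw⟩ := exists_latticeEmb_norm_sub_le (t • c)
  refine ⟨w, fun y hy => ?_⟩
  rw [Metric.mem_closedBall, dist_eq_norm] at hy
  have h1 : ‖y - t • c‖ < t * ε := by
    have := norm_sub_le_norm_sub_add_norm_sub y (latticeEmb w) (t • c)
    linarith [le_abs_self r]
  have h2 : t⁻¹ • y ∈ Metric.ball c ε := by
    have e : t⁻¹ • y - c = t⁻¹ • (y - t • c) := by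
      rw [smul_sub, smul_smul, inv_mul_cancel₀ ht0.ne', one_smul]
    rw [Metric.mem_ball, dist_eq_norm, e, norm_smul, norm_inv, Real.norm_of_nonneg ht0.le,
      inv_mul_lt_iff₀ ht0]
    exact h1
  have := C.smul_mem ht0 (hball h2)
  rwa [smul_smul, mul_inv_cancel₀ ht0.ne', one_smul] at this

theorem ConvexCone.closedBall_natCast_smul_subset {V : Type*} [NormedAddCommGroup V]
    [NormedSpace ℝ V] {C : ConvexCone ℝ V} {w : V} {r : ℝ}
    (h : Metric.closedBall w r ⊆ C) {k : ℕ} (hk : 0 < k) :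
    Metric.closedBall ((k : ℝ) • w) (r * k) ⊆ C := by
  intro y hy
  have hk0 : (0 : ℝ) < k := by exact_mod_cast hk
  have h2 : (k : ℝ)⁻¹ • y ∈ Metric.closedBall w r := by
    have e : (k : ℝ)⁻¹ • y - w = (k : ℝ)⁻¹ • (y - (k : ℝ) • w) := by
      rw [smul_sub, smul_smul, inv_mul_cancel₀ hk0.ne', one_smul]
    rw [Metric.mem_closedBall, dist_eq_norm] at hy ⊢
    rw [e, norm_smul, norm_inv, Real.norm_of_nonneg hk0.le, inv_mul_le_iff₀ hk0]
    linarith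
  have := C.smul_mem hk0 (h h2)
  rwa [smul_smul, mul_inv_cancel₀ hk0.ne', one_smul] at this

/-- A unit ball around a lattice point `w` fits in the cone, so `w` and `w ± e_i` lie in `E`, and
`Communicates.exists_inner_le` bounds each coordinate of `α`. -/
theorem isBounded_subLevelD {μ : PMF (Fin d → ℤ)} {E : Set (Fin d → ℤ)}
    {C : ConvexCone ℝ (EuclideanSpace ℝ (Fin d))} (hcomm : Communicates μ E)
    (hC : IsOpen (C : Set (EuclideanSpace ℝ (Fin d))))
    (hE : E = {x | latticeEmb x ∈ closure (C : Set (EuclideanSpace ℝ (Fin d)))})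
    (hne : (C : Set (EuclideanSpace ℝ (Fin d))).Nonempty) :
    Bornology.IsBounded (subLevelD μ) := by
  obtain ⟨M, hM, hle⟩ := hcomm.exists_inner_le
  obtain ⟨w, hw⟩ := ConvexCone.exists_closedBall_latticeEmb_subset hC hne 1
  have hmem : ∀ x : Fin d → ℤ, ‖latticeEmb x‖ ≤ 1 → w + x ∈ E := by
    intro x hx
    rw [hE]
    apply subset_closure
    apply hw
    simpa [latticeEmb_add] using hx
  have hw0 : w ∈ E := by
    have := hmem 0 (by rw [show latticeEmb (0 : Fin d → ℤ) = 0 by ext; simp]; simp)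
    simpa using this
  have hinner : ∀ α ∈ subLevelD μ, ∀ x : Fin d → ℤ, ‖latticeEmb x‖ ≤ 1 →
      inner ℝ α (latticeEmb x) ≤ M := by
    intro α hα x hx
    have := hle α hα w hw0 (w + x) (hmem x hx)
    rw [latticeEmb_add, add_sub_cancel_left] at this
    exact this.trans (mul_le_of_le_one_right hM hx)
  rw [isBounded_iff_forall_norm_le]
  refine ⟨d * M, fun α hα => norm_le_of_forall_abs_le hM fun i => ?_⟩
  have hs : ∀ a : ℤ, latticeEmb (Pi.single i a) = EuclideanSpace.single i (a : ℝ) := by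
    intro a
    ext j
    rcases eq_or_ne j i with rfl | hj
    · simp
    · simp [hj]
  have h1 := hinner α hα (Pi.single i 1) (by rw [hs]; simp)
  have h2 := hinner α hα (Pi.single i (-1)) (by rw [hs]; simp)
  rw [hs, EuclideanSpace.inner_single_right] at h1 h2
  simp at h1 h2
  exact abs_le.2 ⟨by linarith, h1⟩

end Cone

/-! ### Exponential estimates for leaving a tube. -/

section Tube

variable {d : ℕ} {ι : Type*} [Fintype ι]

/-- Exponential bound for the event that the walk with drift `m`, steered to be at `p` after `n`
more steps, leaves a tube of radius `ρ` in one of the directions `f j`. -/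
noncomputable def tubeFun (f : ι → EuclideanSpace ℝ (Fin d)) (p m : EuclideanSpace ℝ (Fin d))
    (s ρ η : ℝ) (n : ℕ) (w : Fin d → ℤ) : ℝ≥0∞ :=
  ∑ j, ENNReal.ofReal (Real.exp (s * (inner ℝ (f j) (latticeEmb w - p + (n : ℝ) • m) - ρ + n * η)))

variable {f : ι → EuclideanSpace ℝ (Fin d)} {p m : EuclideanSpace ℝ (Fin d)} {s ρ η : ℝ}

/-- Averaging over one step multiplies each exponential by at most `e^{s(⟨f j, m⟩ + η)}`, exactly
what passing from `n` to `n + 1` adds. -/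
theorem tsum_mul_tubeFun_le {ν : PMF (Fin d → ℤ)}
    (hs : ∀ j, stepGenFun ν (s • f j) ≤ ENNReal.ofReal (Real.exp (s * (inner ℝ (f j) m + η))))
    (n : ℕ) (x : Fin d → ℤ) :
    ∑' z, ν z * tubeFun f p m s ρ η n (x + z) ≤ tubeFun f p m s ρ η (n + 1) x := by
  simp only [tubeFun, Finset.mul_sum]
  rw [Summable.tsum_finsetSum fun _ _ => ENNReal.summable]
  refine Finset.sum_le_sum fun j _ => ?_
  have h1 : ∀ z, ν z * ENNReal.ofReal (Real.exp
        (s * (inner ℝ (f j) (latticeEmb (x + z) - p + (n : ℝ) • m) - ρ + n * η)))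
      = ENNReal.ofReal (Real.exp
        (s * (inner ℝ (f j) (latticeEmb x - p + (n : ℝ) • m) - ρ + n * η))) *
        (ENNReal.ofReal (Real.exp (inner ℝ (s • f j) (latticeEmb z))) * ν z) := by
    intro z
    rw [← mul_assoc, ← ofReal_exp_add, mul_comm, real_inner_smul_left, latticeEmb_add]
    congr 3
    simp only [inner_add_right, inner_sub_right]
    ring
  simp only [h1]
  rw [ENNReal.tsum_mul_left, ← stepGenFun]
  refine (mul_le_mul_right (hs j) _).trans_eq ?_
  rw [← ofReal_exp_add]
  congr 2
  simp only [inner_add_right, inner_sub_right, real_inner_smul_right]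
  push_cast
  ring

theorem one_le_tubeFun (hs : 0 ≤ s) (hη : 0 ≤ η) {n : ℕ} {w : Fin d → ℤ} {j : ι}
    (h : ρ ≤ inner ℝ (f j) (latticeEmb w - p + (n : ℝ) • m)) :
    1 ≤ tubeFun f p m s ρ η n w := by
  refine le_trans ?_ (Finset.single_le_sum (fun _ _ => zero_le) (Finset.mem_univ j))
  rw [ENNReal.one_le_ofReal, Real.one_le_exp_iff]
  have : 0 ≤ n * η := by positivity
  exact mul_nonneg hs (by linarith)

theorem tubeFun_le (hs : 0 ≤ s) (hf : ∀ j, ‖f j‖ ≤ 1) {n : ℕ} {w : Fin d → ℤ} {b : ℝ}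
    (hb : ‖latticeEmb w - p + (n : ℝ) • m‖ - ρ + n * η ≤ b) :
    tubeFun f p m s ρ η n w ≤ ENNReal.ofReal (Fintype.card ι * Real.exp (s * b)) := by
  rw [ENNReal.ofReal_mul (by positivity), ENNReal.ofReal_natCast, ← nsmul_eq_mul,
    ← Finset.card_univ]
  refine Finset.sum_le_card_nsmul _ _ _ fun j _ => ?_
  gcongr
  refine le_trans ?_ hb
  gcongr
  refine (real_inner_le_norm _ _).trans ?_
  exact mul_le_of_le_one_left (norm_nonneg _) (hf j)

/-- The coordinate directions and their opposites. -/
noncomputable def axisDir (d : ℕ) : Fin d ⊕ Fin d → EuclideanSpace ℝ (Fin d) :=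
  Sum.elim (fun i => EuclideanSpace.single i 1) (fun i => -EuclideanSpace.single i 1)

theorem norm_axisDir_le (j : Fin d ⊕ Fin d) : ‖axisDir d j‖ ≤ 1 := by
  rcases j with i | i <;> simp [axisDir]

theorem exists_le_inner_axisDir {x : EuclideanSpace ℝ (Fin d)} (hρ : 0 ≤ ρ)
    (h : d * ρ < ‖x‖) : ∃ j, ρ ≤ inner ℝ (axisDir d j) x := by
  by_contra! hcon
  refine absurd h (not_lt.2 (norm_le_of_forall_abs_le hρ fun i => abs_le.2 ⟨?_, ?_⟩))
  · have := hcon (Sum.inr i)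
    simp [axisDir, EuclideanSpace.inner_single_left] at this
    linarith
  · have := hcon (Sum.inl i)
    simp [axisDir, EuclideanSpace.inner_single_left] at this
    linarith

theorem le_add_mul_tubeFun_of_superharmonic {E : Set (Fin d → ℤ)} {ν : PMF (Fin d → ℤ)}
    {g : E → ℝ≥0∞} {c : ℝ≥0∞} {N : ℕ} (hs0 : 0 ≤ s) (hη : 0 ≤ η) (hρ : 0 ≤ ρ)
    (hg : ∀ x : E, ∑' w : E, ν (w.1 - x.1) * g w ≤ g x)
    (hs : ∀ j, stepGenFun ν (s • axisDir d j)
      ≤ ENNReal.ofReal (Real.exp (s * (inner ℝ (axisDir d j) m + η))))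
    (htube : ∀ n ≤ N, ∀ w, ‖latticeEmb w - p + (n : ℝ) • m‖ ≤ d * ρ → w ∈ E)
    (hc : ∀ x : E, ‖latticeEmb x.1 - p‖ ≤ d * ρ → c ≤ g x) (x : E) :
    c ≤ g x + c * tubeFun (axisDir d) p m s ρ η N x := by
  refine le_add_mul_of_superharmonic hg (tsum_mul_tubeFun_le hs) (N := N) ?_ ?_ N le_rfl x
  · intro n hn w hw
    obtain ⟨j, hj⟩ := exists_le_inner_axisDir hρ (not_le.1 (mt (htube n hn w) hw))
    exact one_le_tubeFun hs0 hη hj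
  · intro x
    by_cases hx : ‖latticeEmb x.1 - p‖ ≤ d * ρ
    · exact (hc x hx).trans le_self_add
    · obtain ⟨j, hj⟩ := exists_le_inner_axisDir hρ (not_le.1 hx)
      have h1 : 1 ≤ tubeFun (axisDir d) p m s ρ η 0 x.1 :=
        one_le_tubeFun hs0 hη (j := j) (by simpa using hj)
      exact (mul_one c ▸ mul_le_mul_right h1 c).trans le_add_self

end Tube

/-! ### Green function under the tilted kernel. -/

section TiltedGreen

variable {d : ℕ} {μ : PMF (Fin d → ℤ)} {E : Set (Fin d → ℤ)}

/-- Doob transform: the weight `e^{⟨α, y - x⟩}` turns superharmonicity of `G(·, y)` for the killed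
walk into superharmonicity for the tilted one. -/
theorem tsum_tiltPMF_mul_green_le {α : EuclideanSpace ℝ (Fin d)} (h : stepGenFun μ α = 1)
    (x y : E) :
    ∑' w : E, tiltPMF μ α h (w.1 - x.1) *
        (ENNReal.ofReal (Real.exp (inner ℝ α (latticeEmb y.1 - latticeEmb w.1))) * green μ E w y)
      ≤ ENNReal.ofReal (Real.exp (inner ℝ α (latticeEmb y.1 - latticeEmb x.1)))
        * green μ E x y := by
  refine le_trans (le_of_eq ?_) (mul_le_mul_right (tsum_stepProb_mul_green_le μ x y) _)
  rw [← ENNReal.tsum_mul_left]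
  refine tsum_congr fun w => ?_
  have e : inner ℝ α (latticeEmb y.1 - latticeEmb x.1)
      = inner ℝ α (latticeEmb (w.1 - x.1)) + inner ℝ α (latticeEmb y.1 - latticeEmb w.1) := by
    rw [latticeEmb_sub, ← inner_add_right]
    congr 1
    abel
  rw [e, ofReal_exp_add, tiltPMF_apply, stepProb]
  ring

end TiltedGreen

/-! ### Logarithmic asymptotics: upper and lower bounds. -/

section Asymptotics

variable {d : ℕ} {μ : PMF (Fin d → ℤ)} {E : Set (Fin d → ℤ)}
  {C : ConvexCone ℝ (EuclideanSpace ℝ (Fin d))} {u v : EuclideanSpace ℝ (Fin d)} {us vs : ℕ → E}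

theorem eventually_norm_sub_natCast_smul_le {V : Type*} [NormedAddCommGroup V] [NormedSpace ℝ V]
    {x : ℕ → V} {a : V} (h : Tendsto (fun n : ℕ => (n : ℝ)⁻¹ • x n) atTop (𝓝 a)) {θ : ℝ}
    (hθ : 0 < θ) : ∀ᶠ n : ℕ in atTop, ‖x n - (n : ℝ) • a‖ ≤ n * θ := by
  filter_upwards [h.eventually (Metric.closedBall_mem_nhds a hθ), eventually_gt_atTop 0]
    with n hn hn0
  have hn' : (0 : ℝ) < n := by exact_mod_cast hn0
  replace hn : ‖(n : ℝ)⁻¹ • x n - a‖ ≤ θ := by rwa [← dist_eq_norm]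
  have e : x n - (n : ℝ) • a = (n : ℝ) • ((n : ℝ)⁻¹ • x n - a) := by
    rw [smul_sub, smul_smul, mul_inv_cancel₀ hn'.ne', one_smul]
  rw [e, norm_smul, Real.norm_of_nonneg hn'.le]
  exact mul_le_mul_of_nonneg_left hn hn'.le

theorem eventually_le_natCast_mul (a : ℝ) {θ : ℝ} (hθ : 0 < θ) :
    ∀ᶠ n : ℕ in atTop, a ≤ n * θ :=
  (tendsto_natCast_atTop_atTop.atTop_mul_const hθ).eventually_ge_atTop a

theorem eventually_mul_exp_neg_le (a : ℝ) {b θ : ℝ} (hb : 0 < b) (hθ : 0 < θ) :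
    ∀ᶠ n : ℕ in atTop, a * Real.exp (-(n * θ)) ≤ b := by
  have h1 : Tendsto (fun n : ℕ => (n : ℝ) * θ) atTop atTop :=
    tendsto_natCast_atTop_atTop.atTop_mul_const hθ
  have h2 := (Real.tendsto_exp_neg_atTop_nhds_zero.comp h1).const_mul a
  rw [mul_zero] at h2
  exact h2.eventually (ge_mem_nhds hb)

theorem tendsto_inv_smul_sub
    (hus : Tendsto (fun n : ℕ => (n : ℝ)⁻¹ • latticeEmb (us n : Fin d → ℤ)) atTop (𝓝 u))
    (hvs : Tendsto (fun n : ℕ => (n : ℝ)⁻¹ • latticeEmb (vs n : Fin d → ℤ)) atTop (𝓝 v)) :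
    Tendsto (fun n : ℕ => (n : ℝ)⁻¹ • (latticeEmb (vs n : Fin d → ℤ) - latticeEmb (us n).1)) atTop
      (𝓝 (v - u)) := by
  simpa only [smul_sub] using hvs.sub hus

theorem eventually_green_le
    (hus : Tendsto (fun n : ℕ => (n : ℝ)⁻¹ • latticeEmb (us n : Fin d → ℤ)) atTop (𝓝 u))
    (hvs : Tendsto (fun n : ℕ => (n : ℝ)⁻¹ • latticeEmb (vs n : Fin d → ℤ)) atTop (𝓝 v))
    {α α₀ : EuclideanSpace ℝ (Fin d)} (hα : α ∈ subLevelD μ) (hα₀ : stepGenFun μ α₀ < 1)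
    {ε : ℝ} (hε : 0 < ε) :
    ∀ᶠ n : ℕ in atTop, green μ E (us n) (vs n)
      ≤ ENNReal.ofReal (Real.exp (-(n * (inner ℝ α (v - u) - ε)))) := by
  -- The loss `ε` is split in three: moving `α` to `β` with `R(β) < 1`, the convergence of the
  -- increments, and the constant `(1 - R(β))⁻¹`.
  obtain ⟨β, hβ, hβq⟩ : ∃ β, stepGenFun μ β < 1 ∧
      inner ℝ α (v - u) - ε / 3 < inner ℝ β (v - u) := by
    have hlim : Tendsto (fun t : ℝ => inner ℝ ((1 - t) • α + t • α₀) (v - u)) (𝓝[>] 0)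
        (𝓝 (inner ℝ α (v - u))) := by
      have : Continuous fun t : ℝ => inner ℝ ((1 - t) • α + t • α₀) (v - u) := by fun_prop
      simpa using (this.tendsto 0).mono_left nhdsWithin_le_nhds
    obtain ⟨t, ht, ht0, ht1⟩ := ((hlim.eventually (lt_mem_nhds (sub_lt_self _ (by positivity :
      0 < ε / 3)))).and (Ioc_mem_nhdsGT (zero_lt_one' ℝ))).exists
    exact ⟨_, stepGenFun_convex_lt_one μ hα hα₀ ht0 ht1, ht⟩
  have hfin : (1 - stepGenFun μ β)⁻¹ ≠ ∞ := ENNReal.inv_ne_top.2 (tsub_pos_of_lt hβ).ne'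
  have hinner : ∀ᶠ n : ℕ in atTop, inner ℝ β (v - u) - ε / 3
      < inner ℝ β ((n : ℝ)⁻¹ • (latticeEmb (vs n : Fin d → ℤ) - latticeEmb (us n).1)) :=
    (tendsto_const_nhds.inner (tendsto_inv_smul_sub hus hvs)).eventually
      (lt_mem_nhds (sub_lt_self _ (by positivity)))
  filter_upwards [hinner, eventually_gt_atTop 0, eventually_mul_exp_neg_le
    (1 - stepGenFun μ β)⁻¹.toReal one_pos (by positivity : 0 < ε / 3)] with n hn hn0 hexp
  have hn' : (0 : ℝ) < n := by exact_mod_cast hn0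
  refine (green_le μ β _ _).trans ?_
  rw [← ENNReal.ofReal_toReal hfin, ← ENNReal.ofReal_mul ENNReal.toReal_nonneg]
  apply ENNReal.ofReal_le_ofReal
  rw [real_inner_smul_right, lt_inv_mul_iff₀ hn'] at hn
  set X := inner ℝ β (latticeEmb (vs n : Fin d → ℤ) - latticeEmb (us n).1)
  have hX : -X ≤ -(n * (ε / 3)) + -(n * (inner ℝ α (v - u) - ε)) := by
    have : (n : ℝ) * (inner ℝ α (v - u) - ε / 3 - ε / 3) ≤ X :=
      (mul_le_mul_of_nonneg_left (by linarith) hn'.le).trans hn.le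
    linarith
  calc _ ≤ (1 - stepGenFun μ β)⁻¹.toReal *
        (Real.exp (-(n * (ε / 3))) * Real.exp (-(n * (inner ℝ α (v - u) - ε)))) := by
        rw [← Real.exp_add]
        gcongr
    _ ≤ _ := by
        rw [← mul_assoc]
        exact mul_le_of_le_one_left (Real.exp_nonneg _) hexp

theorem eventually_le_green_of_eq (hcomm : Communicates μ E)
    (hus : Tendsto (fun n : ℕ => (n : ℝ)⁻¹ • latticeEmb (us n : Fin d → ℤ)) atTop (𝓝 u))
    (hvs : Tendsto (fun n : ℕ => (n : ℝ)⁻¹ • latticeEmb (vs n : Fin d → ℤ)) atTop (𝓝 u))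
    {ε : ℝ} (hε : 0 < ε) :
    ∀ᶠ n : ℕ in atTop, ENNReal.ofReal (Real.exp (-(n * ε))) ≤ green μ E (us n) (vs n) := by
  obtain ⟨M, hM, hle⟩ := hcomm.exists_harnack
  filter_upwards [eventually_norm_sub_natCast_smul_le (tendsto_inv_smul_sub hus hvs)
    (by positivity : 0 < ε / (M + 1))] with n hn
  rw [sub_self, smul_zero, sub_zero] at hn
  refine le_trans ?_ ((le_mul_of_one_le_right zero_le (one_le_green_self μ (vs n))).trans
    (hle (us n) (vs n) (vs n)))
  gcongr ENNReal.ofReal (Real.exp (-?_))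
  refine (mul_le_mul_of_nonneg_left hn hM).trans ?_
  have : M * (n * (ε / (M + 1))) = n * ε * (M / (M + 1)) := by ring
  rw [this]
  exact mul_le_of_le_one_right (by positivity) (div_le_one_of_le₀ (by linarith) (by positivity))

/-- Bound of the Green function of the killed walk from below at one scale, by following the walk
with the tilted step distribution in a tube inside the cone. -/
theorem half_mul_exp_le_green {M : ℝ} (hM : 0 ≤ M)
    (hharnack : ∀ x y w : E,
      ENNReal.ofReal (Real.exp (-(M * ‖latticeEmb y.1 - latticeEmb x.1‖))) * green μ E y w
        ≤ green μ E x w)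
    {α : EuclideanSpace ℝ (Fin d)} (hα : stepGenFun μ α = 1) {p m : EuclideanSpace ℝ (Fin d)}
    {s ρ η r : ℝ} {N : ℕ} (hs0 : 0 ≤ s) (hη : 0 ≤ η) (hρ : 0 ≤ ρ)
    (hs : ∀ j, stepGenFun (tiltPMF μ α hα) (s • axisDir d j)
      ≤ ENNReal.ofReal (Real.exp (s * (inner ℝ (axisDir d j) m + η))))
    (htube : ∀ n ≤ N, ∀ w, ‖latticeEmb w - p + (n : ℝ) • m‖ ≤ d * ρ → w ∈ E) (x y : E)
    (hy : ‖latticeEmb y.1 - p‖ + d * ρ ≤ r)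
    (hx : tubeFun (axisDir d) p m s ρ η N x ≤ 2⁻¹) :
    2⁻¹ * ENNReal.ofReal (Real.exp (-((‖α‖ + M) * r + inner ℝ α (latticeEmb y.1 - latticeEmb x.1))))
      ≤ green μ E x y := by
  -- Lower bound for the weighted Green function within distance `r` of `y`: `‖α‖ r` pays for the
  -- weight, `M r` for Harnack.
  set c : ℝ≥0∞ := ENNReal.ofReal (Real.exp (-((‖α‖ + M) * r))) with hc
  have hctop : c ≠ ∞ := ENNReal.ofReal_ne_top
  have key := le_add_mul_tubeFun_of_superharmonic (c := c) hs0 hη hρ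
    (fun x => tsum_tiltPMF_mul_green_le hα x y) hs htube ?_ x
  · have h2 : c ≤ ENNReal.ofReal (Real.exp (inner ℝ α (latticeEmb y.1 - latticeEmb x.1)))
        * green μ E x y + c * 2⁻¹ := key.trans (by gcongr)
    have h3 : c = c * 2⁻¹ + c * 2⁻¹ := by
      rw [← mul_add, ENNReal.inv_two_add_inv_two, mul_one]
    have h4 := (ENNReal.add_le_add_iff_right
      (ENNReal.mul_ne_top hctop (ENNReal.inv_ne_top.2 two_ne_zero))).1 (h3.symm.trans_le h2)
    calc _ = (c * 2⁻¹) * ENNReal.ofReal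
          (Real.exp (-inner ℝ α (latticeEmb y.1 - latticeEmb x.1))) := by
          rw [neg_add, ofReal_exp_add, hc]; ring
      _ ≤ _ := mul_le_mul_left h4 _
      _ = green μ E x y := by
          rw [mul_right_comm, ofReal_exp_mul_neg, one_mul]
  · intro z hz
    have hzy : ‖latticeEmb y.1 - latticeEmb z.1‖ ≤ r := by
      have := norm_sub_le_norm_sub_add_norm_sub (latticeEmb y.1) p (latticeEmb z.1)
      rw [norm_sub_rev p] at this
      linarith
    have h1 : ENNReal.ofReal (Real.exp (-(M * ‖latticeEmb y.1 - latticeEmb z.1‖)))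
        ≤ green μ E z y :=
      (le_mul_of_one_le_right zero_le (one_le_green_self μ y)).trans (hharnack z y y)
    refine le_trans ?_ (mul_le_mul_right h1 _)
    rw [hc, ← ofReal_exp_add]
    gcongr
    have h2 := neg_le_of_abs_le
      (abs_real_inner_le_norm α (latticeEmb y.1 - latticeEmb z.1))
    have h3 := mul_le_mul_of_nonneg_left hzy (add_nonneg (norm_nonneg α) hM)
    linarith

/-- The point is `(t - a/τ) v + (a/τ) u + z` with `z` within `r k` of `k w₀`; the coefficients are
nonnegative because `0 ≤ a ≤ τ t`. -/
theorem mem_of_norm_tube_le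
    (hE : E = {x | latticeEmb x ∈ closure (C : Set (EuclideanSpace ℝ (Fin d)))})
    (hu : u ∈ closure (C : Set (EuclideanSpace ℝ (Fin d))))
    (hv : v ∈ closure (C : Set (EuclideanSpace ℝ (Fin d))))
    {m w₀ : EuclideanSpace ℝ (Fin d)} {τ r : ℝ} (hτ : 0 < τ) (hq : v - u = τ • m)
    (hw₀ : Metric.closedBall w₀ r ⊆ C) {k : ℕ} (hk : 0 < k) {t a : ℝ} (ha0 : 0 ≤ a)
    (hat : a ≤ τ * t) {w : Fin d → ℤ}
    (hw : ‖latticeEmb w - (t • v + (k : ℝ) • w₀) + a • m‖ ≤ r * k) : w ∈ E := by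
  rw [hE, Set.mem_ofPred_eq]
  have h1 : latticeEmb w - (t • v + (k : ℝ) • w₀) + a • m + (k : ℝ) • w₀ ∈ closure
      (C : Set (EuclideanSpace ℝ (Fin d))) := by
    apply subset_closure
    apply C.closedBall_natCast_smul_subset hw₀ hk
    simpa using hw
  have h2 := C.smul_add_mem_closure (a := t - a / τ)
    (sub_nonneg.2 ((div_le_iff₀' hτ).2 hat)) hv
    (C.smul_add_mem_closure (div_nonneg ha0 hτ.le) hu h1)
  have hm : a • m = (a / τ) • (v - u) := by
    rw [hq, smul_smul, div_mul_cancel₀ a hτ.ne']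
  convert h2 using 1
  rw [hm, sub_smul, smul_sub]
  abel

theorem exists_eventually_le_green (hcomm : Communicates μ E)
    (hC : IsOpen (C : Set (EuclideanSpace ℝ (Fin d))))
    (hE : E = {x | latticeEmb x ∈ closure (C : Set (EuclideanSpace ℝ (Fin d)))})
    (hR : ∀ᶠ α in 𝓝ˢ (subLevelD μ), stepGenFun μ α < ∞)
    (hu : u ∈ closure (C : Set (EuclideanSpace ℝ (Fin d))))
    (hv : v ∈ closure (C : Set (EuclideanSpace ℝ (Fin d))))
    (hus : Tendsto (fun n : ℕ => (n : ℝ)⁻¹ • latticeEmb (us n : Fin d → ℤ)) atTop (𝓝 u))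
    (hvs : Tendsto (fun n : ℕ => (n : ℝ)⁻¹ • latticeEmb (vs n : Fin d → ℤ)) atTop (𝓝 v))
    {α : EuclideanSpace ℝ (Fin d)} (hα : stepGenFun μ α = 1) {τ : ℝ} (hτ : 0 < τ)
    (hq : v - u = τ • drift (tiltPMF μ α hα)) :
    ∃ B : ℝ, 0 ≤ B ∧ ∀ δ : ℝ, 0 < δ → ∀ᶠ n : ℕ in atTop,
      ENNReal.ofReal (Real.exp (-(n * (inner ℝ α (v - u) + δ * B))))
        ≤ green μ E (us n) (vs n) := by
  obtain ⟨M, hM, hharnack⟩ := hcomm.exists_harnack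
  have hmemE : ∀ w, w ∈ E ↔ latticeEmb w ∈ closure (C : Set (EuclideanSpace ℝ (Fin d))) :=
    fun w => by rw [hE, Set.mem_ofPred_eq]
  have hne : (C : Set (EuclideanSpace ℝ (Fin d))).Nonempty := closure_nonempty_iff.1 ⟨u, hu⟩
  obtain ⟨w₀, hw₀⟩ := C.exists_closedBall_latticeEmb_subset hC hne d
  have hfin := eventually_stepGenFun_tiltPMF_lt_top hR hα
  set m := drift (tiltPMF μ α hα) with hm
  set A : ℝ := 2 * d + 2 * ‖latticeEmb w₀‖ + 1 with hA
  have hA0 : 0 ≤ A := by positivity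
  -- Costs in units of `n δ`: `M A` to move from `us n` to `x₀`, `(‖α‖ + M) A` near the target, `‖α‖
  -- A` for the inner product, and `1` for the factor `1/2`.
  refine ⟨2 * (‖α‖ + M) * A + 1, by positivity, fun δ hδ => ?_⟩
  set η : ℝ := δ / (4 * τ) with hη
  have hη0 : 0 < η := by positivity
  obtain ⟨s, hs, hs0⟩ : ∃ s : ℝ, (∀ j, stepGenFun (tiltPMF μ α hα) (s • axisDir d j)
      ≤ ENNReal.ofReal (Real.exp (s * (inner ℝ (axisDir d j) m + η)))) ∧ 0 < s := by
    refine (Eventually.and (eventually_all.2 fun j => ?_) self_mem_nhdsWithin).exists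
      (f := 𝓝[>] (0 : ℝ))
    exact (eventually_stepGenFun_smul_lt hfin (lt_add_of_pos_right _ hη0)).mono
      fun s hs => hs.le
  filter_upwards [eventually_norm_sub_natCast_smul_le hus (by positivity : 0 < δ / 8),
    eventually_norm_sub_natCast_smul_le hvs (by positivity : 0 < δ / 8),
    eventually_le_natCast_mul ‖m‖ (by positivity : 0 < δ / 8),
    eventually_le_natCast_mul 1 hδ,
    eventually_mul_exp_neg_le (Fintype.card (Fin d ⊕ Fin d)) (by norm_num : (0 : ℝ) < 1 / 2)
      (by positivity : 0 < s * (δ / 2)),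
    eventually_mul_exp_neg_le 1 (by norm_num : (0 : ℝ) < 1 / 2) hδ]
    with n hun hvn hmn hδn hexp hhalf
  have hn0 : (0 : ℝ) ≤ n := Nat.cast_nonneg n
  set k : ℕ := ⌈n * δ⌉₊ with hk
  have hkpos : 0 < k := Nat.ceil_pos.2 (by linarith)
  have hkle : n * δ ≤ k := Nat.le_ceil _
  have hklt : (k : ℝ) ≤ 2 * (n * δ) := by
    have := Nat.ceil_lt_add_one (by linarith : 0 ≤ n * δ)
    linarith
  set N : ℕ := ⌊τ * n⌋₊ with hN
  have hNle : (N : ℝ) ≤ τ * n := Nat.floor_le (by positivity)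
  have hNlt : τ * n < N + 1 := Nat.lt_floor_add_one _
  set p : EuclideanSpace ℝ (Fin d) := (n : ℝ) • v + (k : ℝ) • latticeEmb w₀ with hp
  have hkw : k * ‖latticeEmb w₀‖ ≤ 2 * (n * δ) * ‖latticeEmb w₀‖ := by gcongr
  have hkd : d * (k : ℝ) ≤ d * (2 * (n * δ)) := by gcongr
  have hx₀mem : (us n).1 + k • w₀ ∈ E := by
    have h1 := (hmemE _).1 (us n).2
    have h2 := C.smul_add_mem_closure (Nat.cast_nonneg k)
      (subset_closure (hw₀ (Metric.mem_closedBall_self (Nat.cast_nonneg d)))) h1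
    rw [hmemE, latticeEmb_add, latticeEmb_nsmul, add_comm]
    exact h2
  set x₀ : E := ⟨(us n).1 + k • w₀, hx₀mem⟩ with hx₀
  have hLx₀ : latticeEmb x₀.1 = latticeEmb (us n).1 + (k : ℝ) • latticeEmb w₀ := by
    rw [hx₀, latticeEmb_add, latticeEmb_nsmul]
  have hstart : ‖latticeEmb x₀.1 - p + (N : ℝ) • m‖ ≤ n * (δ / 4) := by
    have e : latticeEmb x₀.1 - p + (N : ℝ) • m
        = (latticeEmb (us n).1 - (n : ℝ) • u) + (N - τ * n : ℝ) • m := by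
      have h1 : (τ * n) • m = (n : ℝ) • (v - u) := by rw [hq, smul_smul, mul_comm]
      rw [sub_smul, h1, hLx₀, hp, smul_sub]
      abel
    rw [e]
    refine (norm_add_le _ _).trans ?_
    rw [norm_smul]
    have : ‖(N - τ * n : ℝ)‖ ≤ 1 := abs_le.2 ⟨by linarith, by linarith⟩
    have := mul_le_of_le_one_left (norm_nonneg m) this
    linarith
  have hNη : N * η ≤ n * (δ / 4) := by
    calc N * η ≤ τ * n * η := by gcongr
      _ = n * (δ / 4) := by rw [hη]; field_simp
  have htubeFun : tubeFun (axisDir d) p m s k η N x₀ ≤ 2⁻¹ := by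
    -- The starting error and `N η` are each at most `n δ / 4`, against the tube parameter `k ≥ n
    -- δ`.
    refine (tubeFun_le hs0.le norm_axisDir_le (b := -(n * (δ / 2))) (by linarith)).trans ?_
    have e : s * -(n * (δ / 2)) = -(n * (s * (δ / 2))) := by ring
    rw [e]
    refine (ENNReal.ofReal_le_ofReal hexp).trans_eq ?_
    rw [one_div, ENNReal.ofReal_inv_of_pos two_pos, ENNReal.ofReal_ofNat]
  have hvp : ‖latticeEmb (vs n).1 - p‖ ≤ n * (δ / 8) + k * ‖latticeEmb w₀‖ := by
    have e : latticeEmb (vs n).1 - p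
        = (latticeEmb (vs n).1 - (n : ℝ) • v) - (k : ℝ) • latticeEmb w₀ := by rw [hp]; abel
    rw [e]
    refine (norm_sub_le _ _).trans ?_
    rw [norm_smul, Real.norm_of_nonneg (Nat.cast_nonneg k)]
    linarith
  have hmain := half_mul_exp_le_green (r := n * δ * A) (ρ := k) hM hharnack hα hs0.le hη0.le
    (Nat.cast_nonneg k) hs (p := p) (N := N)
    (fun j hj w hw => mem_of_norm_tube_le hE hu hv hτ hq hw₀ hkpos (Nat.cast_nonneg j)
      (le_trans (by exact_mod_cast hj) hNle) hw) x₀ (vs n)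
    (by rw [hA]; nlinarith) htubeFun
  have hinner : inner ℝ α (latticeEmb (vs n).1 - latticeEmb x₀.1)
      ≤ n * inner ℝ α (v - u) + ‖α‖ * (n * δ * A) := by
    have e : latticeEmb (vs n).1 - latticeEmb x₀.1 = (n : ℝ) • (v - u)
        + ((latticeEmb (vs n).1 - p) - (latticeEmb (us n).1 - (n : ℝ) • u)) := by
      rw [hLx₀, hp, smul_sub]; abel
    rw [e, inner_add_right, real_inner_smul_right]
    gcongr
    refine (real_inner_le_norm _ _).trans ?_
    gcongr
    refine (norm_sub_le _ _).trans ?_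
    rw [hA]
    have : 0 ≤ (d : ℝ) * (n * δ) := by positivity
    linarith
  have hx₀us : ‖latticeEmb x₀.1 - latticeEmb (us n).1‖ ≤ n * δ * A := by
    rw [hLx₀, add_sub_cancel_left, norm_smul, Real.norm_of_nonneg (Nat.cast_nonneg k), hA]
    have : 0 ≤ (d : ℝ) * (n * δ) := by positivity
    linarith
  have hhalf' : ENNReal.ofReal (Real.exp (-(n * δ))) ≤ 2⁻¹ := by
    refine (ENNReal.ofReal_le_ofReal ((one_mul _).symm.trans_le hhalf)).trans_eq ?_
    rw [one_div, ENNReal.ofReal_inv_of_pos two_pos, ENNReal.ofReal_ofNat]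
  calc ENNReal.ofReal (Real.exp (-(n * (inner ℝ α (v - u) + δ * (2 * (‖α‖ + M) * A + 1)))))
      = ENNReal.ofReal (Real.exp (-(M * (n * δ * A)))) * (ENNReal.ofReal (Real.exp (-(n * δ))) *
          ENNReal.ofReal (Real.exp (-((‖α‖ + M) * (n * δ * A)
            + (n * inner ℝ α (v - u) + ‖α‖ * (n * δ * A)))))) := by
        rw [← ofReal_exp_add, ← ofReal_exp_add]
        congr 2
        ring
    _ ≤ ENNReal.ofReal (Real.exp (-(M * ‖latticeEmb x₀.1 - latticeEmb (us n).1‖))) *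
          (2⁻¹ * ENNReal.ofReal (Real.exp (-((‖α‖ + M) * (n * δ * A)
            + inner ℝ α (latticeEmb (vs n).1 - latticeEmb x₀.1))))) := by
        gcongr
    _ ≤ _ := (mul_le_mul_right hmain _).trans (hharnack (us n) x₀ (vs n))

theorem eventually_le_green (hcomm : Communicates μ E)
    (hC : IsOpen (C : Set (EuclideanSpace ℝ (Fin d))))
    (hE : E = {x | latticeEmb x ∈ closure (C : Set (EuclideanSpace ℝ (Fin d)))})
    (hR : ∀ᶠ α in 𝓝ˢ (subLevelD μ), stepGenFun μ α < ∞) (hdrift : drift μ ≠ 0)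
    (hu : u ∈ closure (C : Set (EuclideanSpace ℝ (Fin d))))
    (hv : v ∈ closure (C : Set (EuclideanSpace ℝ (Fin d))))
    (hus : Tendsto (fun n : ℕ => (n : ℝ)⁻¹ • latticeEmb (us n : Fin d → ℤ)) atTop (𝓝 u))
    (hvs : Tendsto (fun n : ℕ => (n : ℝ)⁻¹ • latticeEmb (vs n : Fin d → ℤ)) atTop (𝓝 v))
    {α : EuclideanSpace ℝ (Fin d)} (hα : α ∈ subLevelD μ)
    (hmax : ∀ β ∈ subLevelD μ, inner ℝ β (v - u) ≤ inner ℝ α (v - u)) {ε : ℝ} (hε : 0 < ε) :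
    ∀ᶠ n : ℕ in atTop, ENNReal.ofReal (Real.exp (-(n * (inner ℝ α (v - u) + ε))))
      ≤ green μ E (us n) (vs n) := by
  rcases eq_or_ne (v - u) 0 with hq | hq
  · obtain rfl := sub_eq_zero.1 hq
    simpa using eventually_le_green_of_eq hcomm hus hvs hε
  · have h1 := stepGenFun_eq_one_of_isMaxOn hR hq hα hmax
    obtain ⟨τ, hτ, hqτ⟩ := exists_eq_smul_drift_of_isMaxOn hR hdrift hq hmax h1
    obtain ⟨B, hB, hle⟩ := exists_eventually_le_green hcomm hC hE hR hu hv hus hvs h1 hτ hqτ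
    -- `B + 1` rather than `B`, since `B` may vanish.
    refine (hle (ε / (B + 1)) (by positivity)).mono fun n hn => le_trans ?_ hn
    gcongr ENNReal.ofReal (Real.exp (-(n * (_ + ?_))))
    rw [div_mul_eq_mul_div, div_le_iff₀ (by positivity)]
    nlinarith

theorem tendsto_log_div_of_eventually_exp_le {G : ℕ → ℝ≥0∞} {a : ℝ}
    (hlower : ∀ ε > 0, ∀ᶠ n : ℕ in atTop, ENNReal.ofReal (Real.exp (-(n * (a + ε)))) ≤ G n)
    (hupper : ∀ ε > 0, ∀ᶠ n : ℕ in atTop, G n ≤ ENNReal.ofReal (Real.exp (-(n * (a - ε))))) :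
    Tendsto (fun n : ℕ => ENNReal.log (G n) / (n : EReal)) atTop (𝓝 (-(a : EReal))) := by
  have hlog : ∀ x : ℝ, ENNReal.log (ENNReal.ofReal (Real.exp x)) = (x : EReal) := fun x => by
    rw [ENNReal.log_ofReal_of_pos (Real.exp_pos x), Real.log_exp]
  have hdiv : ∀ n : ℕ, 0 < n → ∀ b : ℝ,
      ((-(n * b) : ℝ) : EReal) / (n : EReal) = ((-b : ℝ) : EReal) := by
    intro n hn b
    have hn' : (n : ℝ) ≠ 0 := by exact_mod_cast hn.ne'
    rw [← EReal.coe_natCast, ← EReal.coe_div]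
    congr 1
    field_simp
  have hmono : ∀ n : ℕ, Monotone fun x : EReal => x / (n : EReal) := fun n =>
    EReal.monotone_div_right_of_nonneg (by positivity)
  rw [← EReal.coe_neg]
  refine tendsto_order.2 ⟨fun b hb => ?_, fun b hb => ?_⟩
  · obtain ⟨c, hbc, hca⟩ := EReal.lt_iff_exists_real_btwn.1 hb
    have hca' : c < -a := by exact_mod_cast hca
    filter_upwards [hlower (-c - a) (by linarith), eventually_gt_atTop 0] with n hn hn0
    refine hbc.trans_le ?_
    have := hmono n (ENNReal.log_monotone hn)
    simp only [hlog, hdiv n hn0] at this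
    refine le_trans (le_of_eq ?_) this
    congr 1
    ring
  · obtain ⟨c, hac, hcb⟩ := EReal.lt_iff_exists_real_btwn.1 hb
    have hac' : -a < c := by exact_mod_cast hac
    filter_upwards [hupper (c + a) (by linarith), eventually_gt_atTop 0] with n hn hn0
    refine lt_of_le_of_lt ?_ hcb
    have := hmono n (ENNReal.log_monotone hn)
    simp only [hlog, hdiv n hn0] at this
    refine this.trans (le_of_eq ?_)
    congr 1
    ring

end Asymptotics

theorem mainTheorem6 {d : ℕ} (μ : PMF (Fin d → ℤ)) (E : Set (Fin d → ℤ))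
    (C : ConvexCone ℝ (EuclideanSpace ℝ (Fin d)))
    -- the killed walk is transient on `E` and satisfies the communication condition
    (htrans : IsTransientOn μ E) (hcomm : Communicates μ E)
    -- `C` is an open convex cone and `E` consists of the lattice points of its closure
    (hC : IsOpen (C : Set (EuclideanSpace ℝ (Fin d))))
    (hE : E = {x | latticeEmb x ∈ closure (C : Set (EuclideanSpace ℝ (Fin d)))})
    -- `R` is finite in a neighbourhood of `D`, and the drift is nonzero
    (hR : ∀ᶠ α in 𝓝ˢ (subLevelD μ), stepGenFun μ α < ∞) (hdrift : drift μ ≠ 0)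
    (u v : EuclideanSpace ℝ (Fin d))
    (hu : u ∈ closure (C : Set (EuclideanSpace ℝ (Fin d))))
    (hv : v ∈ closure (C : Set (EuclideanSpace ℝ (Fin d))))
    (us vs : ℕ → E)
    (hus : Tendsto (fun n : ℕ => (n : ℝ)⁻¹ • latticeEmb (us n : Fin d → ℤ)) atTop (𝓝 u))
    (hvs : Tendsto (fun n : ℕ => (n : ℝ)⁻¹ • latticeEmb (vs n : Fin d → ℤ)) atTop (𝓝 v)) :
    -- the logarithm and the supremum are taken in `[-∞, ∞]`
    Tendsto (fun n : ℕ => ENNReal.log (green μ E (us n) (vs n)) / (n : EReal)) atTop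
      (𝓝 (-(⨆ α ∈ subLevelD μ, ((inner ℝ α (v - u) : ℝ) : EReal)))) := by
  have hne : (C : Set (EuclideanSpace ℝ (Fin d))).Nonempty := closure_nonempty_iff.1 ⟨u, hu⟩
  have hcompact : IsCompact (subLevelD μ) := Metric.isCompact_of_isClosed_isBounded
    (isClosed_subLevelD μ) (isBounded_subLevelD hcomm hC hE hne)
  obtain ⟨α, hα, hmax⟩ := hcompact.exists_isMaxOn ⟨0, (stepGenFun_zero μ).le⟩
    (f := fun α => inner ℝ α (v - u)) (by fun_prop)
  replace hmax : ∀ β ∈ subLevelD μ, inner ℝ β (v - u) ≤ inner ℝ α (v - u) := hmax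
  obtain ⟨α₀, hα₀⟩ := exists_stepGenFun_lt_one hR hdrift
  have hsup : (⨆ α ∈ subLevelD μ, ((inner ℝ α (v - u) : ℝ) : EReal))
      = ((inner ℝ α (v - u) : ℝ) : EReal) :=
    le_antisymm (iSup₂_le fun β hβ => EReal.coe_le_coe_iff.2 (hmax β hβ))
      (le_iSup₂ (f := fun β (_ : β ∈ subLevelD μ) => ((inner ℝ β (v - u) : ℝ) : EReal)) α hα)
  rw [hsup]
  exact tendsto_log_div_of_eventually_exp_le
    (fun ε hε => eventually_le_green hcomm hC hE hR hdrift hu hv hus hvs hα hmax hε)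
    (fun ε hε => eventually_green_le hus hvs hα hα₀ hε)
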